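/- Let $n\ge 1$, let $A\in\mathbb{C}^{n\times n}$ be nonsingular, and let $k\ge 0$ be an integer. Let $\pi_k$ denote the set of polynomials $p$ with complex coefficients, of degree at most $k$ and with $p(0)=1$, let $\|\cdot\|$ be the matrix norm induced by the Euclidean norm on $\mathbb{C}^n$, let $\mathcal F(B)=\{v^HBv : v\in\mathbb{C}^n,\ \|v\|=1\}$ be the field of values of a matrix $B\in\mathbb{C}^{n\times n}$, and let $\nu(\mathcal F(B))=\min_{z\in\mathcal F(B)}|z|$ be its distance from the origin. Then the minimum $\min_{p\in\pi_k}\|p(A)\|$ (the value of the $k$-th ideal GMRES approximation) is attained and $$\min_{p\in\pi_k}\|p(A)\|\le\bigl(1-\nu(\mathcal F(A))\,\nu(\mathcal F(A^{-1}))\bigr)^{k/2}.$$ Moreover, if the Hermitian part $M=\tfrac12(A+A^H)$ is positive definite, then $$\min_{p\in\pi_k}\|p(A)\|\le\left(1-\frac{\lambda_{\min}(M)^2}{\lambda_{\max}(A^HA)}\right)^{k/2},$$ where $\lambda_{\min}(M)$ and $\lambda_{\max}(A^HA)$ denote the smallest eigenvalue of $M$ and the largest eigenvalue of $A^HA$.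 -/

import Mathlib

open Polynomial
open scoped ComplexOrder

/-- The spectral norm `‖B‖ = max_{v ≠ 0} ‖B v‖ / ‖v‖` of a square complex matrix, i.e. its operator
norm with respect to the Euclidean norm. -/
noncomputable def spectralNorm2 {n : ℕ} (B : Matrix (Fin n) (Fin n) ℂ) : ℝ :=
  ‖Matrix.toEuclideanCLM (n := Fin n) (𝕜 := ℂ) B‖

/-- The field of values `F(A) = {v^H A v : ‖v‖ = 1}`. Mathlib's inner product is conjugate linear
in its first argument, so `inner ℂ v (A v) = v^H A v`. -/
noncomputable def fieldOfValues {n : ℕ} (A : Matrix (Fin n) (Fin n) ℂ) : Set ℂ :=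
  {z | ∃ v : EuclideanSpace ℂ (Fin n), ‖v‖ = 1 ∧
    z = inner ℂ v (Matrix.toEuclideanCLM (n := Fin n) (𝕜 := ℂ) A v)}

/-- The distance `ν(S)` of a set `S` of complex numbers from the origin. -/
noncomputable def distOrigin (S : Set ℂ) : ℝ :=
  Metric.infDist 0 S

/-- `π_k`: complex polynomials `p` of degree at most `k` with `p(0) = 1`. -/
def residualPolys (k : ℕ) : Set ℂ[X] :=
  {p | p.natDegree ≤ k ∧ p.eval 0 = 1}

/-- The set of all values `‖p(A)‖`, `p ∈ π_k`. -/
noncomputable def residualNorms {n : ℕ} (k : ℕ) (A : Matrix (Fin n) (Fin n) ℂ) : Set ℝ :=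
  (fun p : ℂ[X] => spectralNorm2 (aeval A p)) '' residualPolys k

/-- The value of the `k`-th ideal GMRES approximation problem, `min_{p ∈ π_k} ‖p(A)‖`.
The theorem asserts separately that this infimum is attained. -/
noncomputable def idealGMRES {n : ℕ} (k : ℕ) (A : Matrix (Fin n) (Fin n) ℂ) : ℝ :=
  sInf (residualNorms k A)

/-- The Hermitian part `M = (A + A^H) / 2`. -/
noncomputable def hermitianPart {n : ℕ} (A : Matrix (Fin n) (Fin n) ℂ) :
    Matrix (Fin n) (Fin n) ℂ :=
  (1 / 2 : ℂ) • (A + A.conjTranspose)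

/-- The smallest eigenvalue of a Hermitian matrix. -/
noncomputable def lambdaMin {n : ℕ} {H : Matrix (Fin n) (Fin n) ℂ} (hH : H.IsHermitian) : ℝ :=
  ⨅ i, hH.eigenvalues i

/-- The largest eigenvalue of a Hermitian matrix. -/
noncomputable def lambdaMax {n : ℕ} {H : Matrix (Fin n) (Fin n) ℂ} (hH : H.IsHermitian) : ℝ :=
  ⨆ i, hH.eigenvalues i

/-- For `n ≥ 1` the distance of the field of values from the origin is a minimum. -/
theorem isLeast_distOrigin_fieldOfValues {n : ℕ} (hn : 0 < n) (A : Matrix (Fin n) (Fin n) ℂ) :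
    IsLeast ((fun z : ℂ => ‖z‖) '' fieldOfValues A) (distOrigin (fieldOfValues A)) := by
  have himg : fieldOfValues A = (fun v : EuclideanSpace ℂ (Fin n) =>
      inner ℂ v (Matrix.toEuclideanCLM (n := Fin n) (𝕜 := ℂ) A v)) '' Metric.sphere 0 1 := by
    ext z
    simp [fieldOfValues, eq_comm]
  have hc : IsCompact (fieldOfValues A) := by
    rw [himg]
    exact (isCompact_sphere _ _).image (by fun_prop)
  have hne : (fieldOfValues A).Nonempty :=
    ⟨_, EuclideanSpace.single ⟨0, hn⟩ 1, by simp, rfl⟩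
  obtain ⟨z, hz, h⟩ := hc.exists_infDist_eq_dist hne 0
  refine ⟨⟨z, hz, ?_⟩, ?_⟩
  · simp [distOrigin, h]
  · rintro _ ⟨w, hw, rfl⟩
    simpa [distOrigin] using Metric.infDist_le_dist_of_mem (x := (0 : ℂ)) hw

/-!
The minimum is attained because the matrices `q(A)` with `deg q ≤ k` and `q(0) = 0` form a
finite-dimensional, hence closed, subspace, and for `p = 1 + q` the norm `‖p(A)‖` is
the distance from `-I` to the point `q(A)` of that subspace (`isLeast_idealGMRES`).

Both bounds come from the polynomials `p = (1 - α X) ^ k`, for which `‖p(A)‖ ≤ ‖I - α A‖ ^ k`.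
Since `‖v - α A v‖² = ‖v‖² - (2 Re (α ⟨v, A v⟩) - |α|² ‖A v‖²)`, a lower bound `c ‖v‖²` for the
bracket gives `(1 - c) ^ (k / 2)` (`idealGMRES_le_of_quadratic`), and the point is to choose `α`.

For the field of values bound put `ν = ν(F(A))` and `ν' = ν(F(A⁻¹))`. A field of values
that misses the origin lies in a closed half-plane at the same distance from it as the set itself,
which is the part of the Toeplitz-Hausdorff theorem that is needed
(`exists_rotation_fieldOfValues`; for distance zero the rotation factor is replaced by `0`).
Applied to `A` at `v` and to `A⁻¹` at `A v`, it gives `u`, `u'` of modulus at most one such that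
`Re (u ⟨v, A v⟩) ≥ ν ‖v‖²` and `Re (conj u' ⟨v, A v⟩) ≥ ν' ‖A v‖²`. The average
`α = ν' (u + conj u') / 2` satisfies `|α| ≤ ν'`, so the bracket is at least
`ν' (ν ‖v‖² + ν' ‖A v‖²) - ν'² ‖A v‖² = ν ν' ‖v‖²`. This choice is explicit, so no minimax argument
over `α` and `v` is required.

If the Hermitian part is positive definite, `α = λ_min(M) / λ_max(Aᴴ A)` works directly.
-/

/-! ### Supporting half-planes of the field of values -/

section HalfPlane

variable {E : Type*} [NormedAddCommGroup E] [InnerProductSpace ℂ E]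

/-- If, over unit vectors, the modulus of `⟨v, T v⟩` is minimised at `v₀`, with `⟨v₀, T v₀⟩ = ν > 0`,
then the numerical range lies in the half-plane `Re z ≥ ν`.
Otherwise `T` takes a value of real part less than `ν` at some `w`, and a small step from `v₀` in
the direction of `w`, with a suitable phase, moves the value from `ν` straight towards it, and so
closer to the origin. -/
theorem re_inner_ge_of_isMin (T : E →L[ℂ] E) {ν : ℝ} (hν : 0 < ν) {v₀ : E} (hv₀ : ‖v₀‖ = 1)
    (h₀ : inner ℂ v₀ (T v₀) = (ν : ℂ)) (hmin : ∀ v, ν * ‖v‖ ^ 2 ≤ ‖inner ℂ v (T v)‖) (w : E) :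
    ν * ‖w‖ ^ 2 ≤ (inner ℂ w (T w)).re := by
  by_contra! hw
  -- the sesquilinear form of `T - ν`
  set q : E → E → ℂ := fun x y => inner ℂ x (T y) - ν * inner ℂ x y with hq
  have hnsq (x : E) : inner ℂ x x = ((‖x‖ ^ 2 : ℝ) : ℂ) := by
    rw [inner_self_eq_norm_sq_to_K]; push_cast; rfl
  have hDre : (q w w).re < 0 := by
    simp only [hq, hnsq, Complex.sub_re, Complex.re_ofReal_mul, Complex.ofReal_re]
    linarith
  have hD0 : q w w ≠ 0 := fun h => by simp [h] at hDre
  -- a scalar `e` for which `q x x` at `x = v₀ + s • e • w` stays on the ray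
  -- through `q w w` for all `s ≥ 0`
  obtain ⟨e, he, r, hr, hcross⟩ : ∃ e : ℂ, e ≠ 0 ∧ ∃ r : ℝ, 0 ≤ r ∧
      e * q v₀ w + starRingEnd ℂ e * q w v₀ = r * q w w := by
    set a := q v₀ w / q w w with ha
    set b := q w v₀ / q w w with hb
    obtain ⟨e, he, him⟩ : ∃ e : ℂ, e ≠ 0 ∧ (e * a + starRingEnd ℂ e * b).im = 0 := by
      by_cases hg : a - starRingEnd ℂ b = 0
      · refine ⟨1, one_ne_zero, ?_⟩
        have := congrArg Complex.im hg
        simp at this ⊢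
        linarith
      · refine ⟨starRingEnd ℂ (a - starRingEnd ℂ b), (_root_.map_ne_zero _).2 hg, ?_⟩
        simp
        ring
    have key : (((e * a + starRingEnd ℂ e * b).re : ℝ) : ℂ) * q w w
        = e * q v₀ w + starRingEnd ℂ e * q w v₀ := by
      rw [show (((e * a + starRingEnd ℂ e * b).re : ℝ) : ℂ) = e * a + starRingEnd ℂ e * b from
        Complex.ext (by simp) (by simpa using him.symm), ha, hb]
      field_simp
    -- replacing `e` by `-e` changes the sign of the real ratio `r`
    rcases le_total 0 (e * a + starRingEnd ℂ e * b).re with h | h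
    · exact ⟨e, he, _, h, key.symm⟩
    · refine ⟨-e, neg_ne_zero.2 he, -(e * a + starRingEnd ℂ e * b).re, by linarith, ?_⟩
      rw [Complex.ofReal_neg, neg_mul ((_ : ℝ) : ℂ), key, map_neg]
      ring
  set D := q w w with hD
  set m : ℝ := ‖e‖ ^ 2 with hm
  have hmpos : 0 < m := by positivity
  set x : ℝ → E := fun s => v₀ + ((s : ℂ) * e) • w with hx
  have hee : starRingEnd ℂ e * e = (m : ℂ) := by
    rw [Complex.conj_mul']; simp [hm]
  have hval (s : ℝ) : inner ℂ (x s) (T (x s))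
      = ((ν * ‖x s‖ ^ 2 : ℝ) : ℂ) + ((s * r + s ^ 2 * m : ℝ) : ℂ) * D := by
    have h1 : q (x s) (x s) = ((s * r + s ^ 2 * m : ℝ) : ℂ) * D := by
      have hqv : q v₀ v₀ = 0 := by simp [hq, h₀, hv₀]
      have : q (x s) (x s) = q v₀ v₀ + s * (e * q v₀ w + starRingEnd ℂ e * q w v₀)
          + s ^ 2 * (starRingEnd ℂ e * e) * q w w := by
        simp only [hq, hx, map_add, map_smul, inner_add_left, inner_add_right, inner_smul_left,
          inner_smul_right, map_mul, Complex.conj_ofReal]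
        ring
      rw [this, hqv, hcross, hee]
      push_cast
      ring
    have h2 : inner ℂ (x s) (T (x s)) = ν * inner ℂ (x s) (x s) + q (x s) (x s) := by
      simp [hq]
    rw [h2, h1, hnsq]
    push_cast
    ring
  -- with `τ = s * r + s ^ 2 * m`, positivity of this quantity says that
  -- `‖ν * ‖x s‖ ^ 2 + τ * D‖ < ν * ‖x s‖ ^ 2`; at `s = 0` it equals `2 * ν * (-D.re) > 0`
  have hpos : ∀ᶠ s : ℝ in nhdsWithin 0 (Set.Ioi 0),
      0 < 2 * ν * ‖x s‖ ^ 2 * (-D.re) - (s * r + s ^ 2 * m) * ‖D‖ ^ 2 := by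
    have hc : Continuous fun s : ℝ =>
        2 * ν * ‖x s‖ ^ 2 * (-D.re) - (s * r + s ^ 2 * m) * ‖D‖ ^ 2 := by
      fun_prop
    refine (hc.tendsto 0).eventually_const_lt ?_ |>.filter_mono nhdsWithin_le_nhds
    simp only [hx, hv₀, Complex.ofReal_zero, zero_mul, zero_smul, add_zero]
    nlinarith
  obtain ⟨s, hs, hs0⟩ := (hpos.and self_mem_nhdsWithin).exists
  have hs0 : 0 < s := hs0
  set τ := s * r + s ^ 2 * m with hτ
  have hτ0 : 0 < τ := by positivity
  have h1 := pow_le_pow_left₀ (by positivity) (hmin (x s)) 2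
  rw [hval, Complex.sq_norm, Complex.normSq_apply] at h1
  rw [Complex.sq_norm D, Complex.normSq_apply] at hs
  simp only [Complex.add_re, Complex.add_im, Complex.re_ofReal_mul, Complex.im_ofReal_mul,
    Complex.ofReal_re, Complex.ofReal_im] at h1
  nlinarith [mul_pos hτ0 hs]

/-- A numerical range whose distance `ν > 0` from the origin is attained lies in a closed half-plane
at distance `ν` from the origin. Allowing `‖u‖ ≤ 1` rather than `‖u‖ = 1` makes the statement
trivially true for `ν = 0`. -/
theorem exists_rotation_re_inner_ge (T : E →L[ℂ] E) {ν : ℝ}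
    (hν : ∃ v, ‖v‖ = 1 ∧ ‖inner ℂ v (T v)‖ = ν)
    (hmin : ∀ v, ν * ‖v‖ ^ 2 ≤ ‖inner ℂ v (T v)‖) :
    ∃ u : ℂ, ‖u‖ ≤ 1 ∧ ∀ w, ν * ‖w‖ ^ 2 ≤ (u * inner ℂ w (T w)).re := by
  obtain ⟨v₀, hv₀, h₀⟩ := hν
  -- for `ν = 0` there is nothing to separate, and `u = 0` serves
  rcases (norm_nonneg (inner ℂ v₀ (T v₀))).eq_or_lt with h | h
  · exact ⟨0, by simp, by simp [← h₀, ← h]⟩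
  rw [h₀] at h
  set u : ℂ := starRingEnd ℂ (inner ℂ v₀ (T v₀)) / ν with hu
  have hu1 : ‖u‖ = 1 := by
    rw [hu, norm_div, RCLike.norm_conj, h₀, Complex.norm_real, Real.norm_of_nonneg h.le,
      div_self h.ne']
  refine ⟨u, hu1.le, fun w => ?_⟩
  have key := re_inner_ge_of_isMin (u • T) h hv₀ ?_ (fun v => ?_) w
  · simpa [inner_smul_right] using key
  · have hν : (ν : ℂ) ≠ 0 := by exact_mod_cast h.ne'
    rw [_root_.smul_apply, inner_smul_right, hu, div_mul_eq_mul_div,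
      Complex.conj_mul', h₀]
    field_simp
  · rw [_root_.smul_apply, inner_smul_right, norm_mul, hu1, one_mul]
    exact hmin v

end HalfPlane

/-! ### Half-planes containing the field of values of a matrix -/

section Residual

variable {n : ℕ}

local notation "𝓛" => Matrix.toEuclideanCLM (n := Fin n) (𝕜 := ℂ)

theorem distOrigin_fieldOfValues_spec (hn : 0 < n) (B : Matrix (Fin n) (Fin n) ℂ) :
    (∃ v, ‖v‖ = 1 ∧ ‖inner ℂ v (𝓛 B v)‖ = distOrigin (fieldOfValues B)) ∧
      ∀ v, distOrigin (fieldOfValues B) * ‖v‖ ^ 2 ≤ ‖inner ℂ v (𝓛 B v)‖ := by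
  obtain ⟨⟨z, ⟨v, hv, rfl⟩, hz⟩, hlb⟩ := isLeast_distOrigin_fieldOfValues hn B
  refine ⟨⟨v, hv, hz⟩, fun w => ?_⟩
  rcases eq_or_ne w 0 with rfl | hw
  · simp
  have hw0 : 0 < ‖w‖ := norm_pos_iff.2 hw
  have := hlb ⟨_, ⟨((‖w‖⁻¹ : ℝ) : ℂ) • w, by simp [norm_smul, hw0.ne'], rfl⟩, rfl⟩
  simp only [map_smul, inner_smul_left, inner_smul_right, Complex.conj_ofReal, norm_mul,
    Complex.norm_real, norm_inv, norm_norm] at this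
  calc _ ≤ (‖w‖⁻¹ * (‖w‖⁻¹ * ‖inner ℂ w (𝓛 B w)‖)) * ‖w‖ ^ 2 := by gcongr
    _ = _ := by field_simp

theorem exists_rotation_fieldOfValues (hn : 0 < n) (B : Matrix (Fin n) (Fin n) ℂ) :
    ∃ u : ℂ, ‖u‖ ≤ 1 ∧
      ∀ w, distOrigin (fieldOfValues B) * ‖w‖ ^ 2 ≤ (u * inner ℂ w (𝓛 B w)).re :=
  exists_rotation_re_inner_ge _ (distOrigin_fieldOfValues_spec hn B).1
    (distOrigin_fieldOfValues_spec hn B).2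

/-! ### Attainment of the minimum -/

theorem residualNorms_bddBelow (k : ℕ) (A : Matrix (Fin n) (Fin n) ℂ) :
    BddBelow (residualNorms k A) :=
  ⟨0, by rintro _ ⟨p, -, rfl⟩; exact norm_nonneg _⟩

theorem isLeast_idealGMRES (k : ℕ) (A : Matrix (Fin n) (Fin n) ℂ) :
    IsLeast (residualNorms k A) (idealGMRES k A) := by
  -- the polynomials of degree at most `k` that vanish at `0`
  let S : Submodule ℂ ℂ[X] := degreeLE ℂ k ⊓ LinearMap.ker (Polynomial.leval (0 : ℂ))
  let φ : ℂ[X] →ₗ[ℂ] (EuclideanSpace ℂ (Fin n) →L[ℂ] EuclideanSpace ℂ (Fin n)) :=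
    (𝓛 : _ ≃⋆ₐ[ℂ] _).toAlgEquiv.toLinearMap ∘ₗ (aeval A).toLinearMap
  have hφ (p : ℂ[X]) : φ p = 𝓛 (aeval A p) := rfl
  have hφ1 : φ 1 = 1 := by simp [hφ]
  have hcl : IsClosed
      (S.map φ : Set (EuclideanSpace ℂ (Fin n) →L[ℂ] EuclideanSpace ℂ (Fin n))) :=
    (S.map φ).closed_of_finiteDimensional
  obtain ⟨y, hy, hdist⟩ := hcl.exists_infDist_eq_dist ⟨0, (S.map φ).zero_mem⟩ (-1)
  obtain ⟨p, hp, rfl⟩ := hy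
  have hmem (q : ℂ[X]) : q ∈ S ↔ 1 + q ∈ residualPolys k := by
    have : (1 + q).natDegree = q.natDegree := by
      rw [add_comm, ← map_one C, natDegree_add_C]
    simp [S, residualPolys, mem_degreeLE, ← natDegree_le_iff_degree_le, this]
  have hnorm (q : ℂ[X]) : spectralNorm2 (aeval A (1 + q)) = dist (-1) (φ q) := by
    rw [dist_comm, dist_eq_norm, sub_neg_eq_add, ← hφ1, add_comm, ← map_add]
    rfl
  have hleast : IsLeast (residualNorms k A) (spectralNorm2 (aeval A (1 + p))) := by
    refine ⟨⟨_, (hmem p).1 hp, rfl⟩, ?_⟩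
    rintro _ ⟨q, hq, rfl⟩
    have hq' : q - 1 ∈ S := (hmem _).2 (by simpa using hq)
    have := Metric.infDist_le_dist_of_mem (x := -1) (Submodule.mem_map_of_mem (f := φ) hq')
    rwa [hdist, ← hnorm, ← hnorm, add_sub_cancel] at this
  rw [idealGMRES, hleast.csInf_eq]
  exact hleast

/-! ### Bounds from powers of a linear polynomial -/

/-- The hypothesis says that `‖v - α A v‖² ≤ (1 - c) ‖v‖²`; the bound is the one obtained from the
polynomial `(1 - α X) ^ k`. -/
theorem idealGMRES_le_of_quadratic (hn : 0 < n) (A : Matrix (Fin n) (Fin n) ℂ) (k : ℕ) (α : ℂ)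
    {c : ℝ} (h : ∀ v, c * ‖v‖ ^ 2 ≤
      2 * (α * inner ℂ v (𝓛 A v)).re - ‖α‖ ^ 2 * ‖𝓛 A v‖ ^ 2) :
    idealGMRES k A ≤ (1 - c) ^ ((k : ℝ) / 2) := by
  have hsq (v : EuclideanSpace ℂ (Fin n)) :
      ‖𝓛 (1 - α • A) v‖ ^ 2 ≤ (1 - c) * ‖v‖ ^ 2 := by
    have : ‖𝓛 (1 - α • A) v‖ ^ 2
        = ‖v‖ ^ 2 - 2 * (α * inner ℂ v (𝓛 A v)).re + ‖α‖ ^ 2 * ‖𝓛 A v‖ ^ 2 := by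
      rw [map_sub, map_one, map_smul, _root_.sub_apply,
        one_apply_eq_self, _root_.smul_apply, @norm_sub_sq ℂ,
        inner_smul_right, norm_smul, mul_pow]
      rfl
    linarith [h v]
  -- `n > 0` is needed here: a unit vector shows that the base of the power is nonnegative
  have hc : 0 ≤ 1 - c := by
    have := hsq (EuclideanSpace.single ⟨0, hn⟩ 1)
    simp only [PiLp.norm_single, norm_one, one_pow, mul_one] at this
    exact (sq_nonneg _).trans this
  have hnorm : ‖𝓛 (1 - α • A)‖ ≤ √(1 - c) := by
    refine ContinuousLinearMap.opNorm_le_bound _ (Real.sqrt_nonneg _) fun v => ?_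
    rw [← Real.sqrt_sq (norm_nonneg v), ← Real.sqrt_mul hc]
    exact Real.le_sqrt_of_sq_le (hsq v)
  have hp : (1 - C α * X) ^ k ∈ residualPolys k := by
    refine ⟨?_, by simp⟩
    compute_degree
  -- makes the operator norm of `1` equal to one, which covers `k = 0`
  have : Nontrivial (EuclideanSpace ℂ (Fin n)) := by
    have : Nonempty (Fin n) := ⟨⟨0, hn⟩⟩
    infer_instance
  calc idealGMRES k A ≤ spectralNorm2 (aeval A ((1 - C α * X) ^ k)) :=
        csInf_le (residualNorms_bddBelow k A) ⟨_, hp, rfl⟩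
    _ = ‖𝓛 (1 - α • A) ^ k‖ := by
        simp [spectralNorm2, Algebra.smul_def]
    _ ≤ ‖𝓛 (1 - α • A)‖ ^ k := norm_pow_le _ _
    _ ≤ √(1 - c) ^ k := by gcongr
    _ = (1 - c) ^ ((k : ℝ) / 2) := by
        rw [Real.sqrt_eq_rpow, ← Real.rpow_natCast, ← Real.rpow_mul hc]
        congr 1
        ring

theorem idealGMRES_le_fieldOfValues (hn : 0 < n) (A : Matrix (Fin n) (Fin n) ℂ) (hA : IsUnit A)
    (k : ℕ) : idealGMRES k A ≤
      (1 - distOrigin (fieldOfValues A) * distOrigin (fieldOfValues A⁻¹)) ^ ((k : ℝ) / 2) := by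
  obtain ⟨u, hu, hA1⟩ := exists_rotation_fieldOfValues hn A
  obtain ⟨u', hu', hA2⟩ := exists_rotation_fieldOfValues hn A⁻¹
  set ν := distOrigin (fieldOfValues A)
  set ν' := distOrigin (fieldOfValues A⁻¹)
  have hν' : 0 ≤ ν' := Metric.infDist_nonneg
  refine idealGMRES_le_of_quadratic hn A k (ν' / 2 * (u + starRingEnd ℂ u')) fun v => ?_
  have h1 := hA1 v
  have h2 := hA2 (𝓛 A v)
  have hinv : 𝓛 A⁻¹ (𝓛 A v) = v := by
    rw [← mul_apply_eq_comp, ← map_mul,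
      Matrix.nonsing_inv_mul _ ((Matrix.isUnit_iff_isUnit_det A).1 hA), map_one,
      one_apply_eq_self]
  -- `⟨A v, v⟩` is the conjugate of `⟨v, A v⟩`, so the rotation for `A⁻¹` enters as `conj u'`
  rw [hinv, ← inner_conj_symm, ← Complex.conj_re, map_mul, Complex.conj_conj] at h2
  have hα : ‖(ν' / 2 * (u + starRingEnd ℂ u') : ℂ)‖ ≤ ν' := by
    have := norm_add_le u (starRingEnd ℂ u')
    rw [RCLike.norm_conj] at this
    rw [norm_mul, norm_div, Complex.norm_real, Real.norm_of_nonneg hν', Complex.norm_ofNat]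
    nlinarith
  have hα2 : ‖(ν' / 2 * (u + starRingEnd ℂ u') : ℂ)‖ ^ 2 ≤ ν' ^ 2 := by gcongr
  have hre : 2 * (ν' / 2 * (u + starRingEnd ℂ u') * inner ℂ v (𝓛 A v) : ℂ).re
      = ν' * ((u * inner ℂ v (𝓛 A v)).re + (starRingEnd ℂ u' * inner ℂ v (𝓛 A v)).re) := by
    rw [← Complex.add_re, ← Complex.re_ofReal_mul, ← Complex.re_ofReal_mul]
    congr 1
    push_cast
    ring
  rw [hre]
  nlinarith [mul_le_mul_of_nonneg_left h1 hν', mul_le_mul_of_nonneg_left h2 hν',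
    mul_le_mul_of_nonneg_right hα2 (sq_nonneg ‖𝓛 A v‖)]

/-! ### The bound by extreme eigenvalues -/

theorem inner_toEuclideanCLM_eq_sum_eigenvalues {H : Matrix (Fin n) (Fin n) ℂ}
    (hH : H.IsHermitian) (v : EuclideanSpace ℂ (Fin n)) :
    (inner ℂ v (𝓛 H v)).re
      = ∑ i, hH.eigenvalues i * ‖inner ℂ (hH.eigenvectorBasis i) v‖ ^ 2 := by
  have hb (i : Fin n) : 𝓛 H (hH.eigenvectorBasis i)
      = (hH.eigenvalues i : ℂ) • hH.eigenvectorBasis i := by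
    ext j
    have := congrFun (hH.mulVec_eigenvectorBasis i) j
    simpa [Matrix.ofLp_toEuclideanCLM] using this
  have hsymm : ∀ x y, inner ℂ (𝓛 H x) y = inner ℂ x (𝓛 H y) :=
    Matrix.isSymmetric_toEuclideanLin_iff.2 hH
  rw [← hH.eigenvectorBasis.sum_inner_mul_inner, Complex.re_sum]
  refine Finset.sum_congr rfl fun i _ => ?_
  rw [← hsymm, hb, inner_smul_left, Complex.conj_ofReal, mul_left_comm, Complex.re_ofReal_mul,
    ← inner_conj_symm v, Complex.conj_mul', ← Complex.ofReal_pow, Complex.ofReal_re]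

theorem lambdaMin_mul_le {H : Matrix (Fin n) (Fin n) ℂ} (hH : H.IsHermitian)
    (v : EuclideanSpace ℂ (Fin n)) : lambdaMin hH * ‖v‖ ^ 2 ≤ (inner ℂ v (𝓛 H v)).re := by
  rw [inner_toEuclideanCLM_eq_sum_eigenvalues hH, ← hH.eigenvectorBasis.sum_sq_norm_inner_right v,
    Finset.mul_sum]
  gcongr with i
  exact ciInf_le (Set.finite_range _).bddBelow i

theorem le_lambdaMax_mul {H : Matrix (Fin n) (Fin n) ℂ} (hH : H.IsHermitian)
    (v : EuclideanSpace ℂ (Fin n)) : (inner ℂ v (𝓛 H v)).re ≤ lambdaMax hH * ‖v‖ ^ 2 := by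
  rw [inner_toEuclideanCLM_eq_sum_eigenvalues hH, ← hH.eigenvectorBasis.sum_sq_norm_inner_right v,
    Finset.mul_sum]
  gcongr with i
  exact le_ciSup (Set.finite_range _).bddAbove i

theorem inner_toEuclideanCLM_conjTranspose (B : Matrix (Fin n) (Fin n) ℂ)
    (x y : EuclideanSpace ℂ (Fin n)) :
    inner ℂ x (𝓛 B.conjTranspose y) = inner ℂ (𝓛 B x) y := by
  rw [← Matrix.star_eq_conjTranspose, map_star, ContinuousLinearMap.star_eq_adjoint,
    ContinuousLinearMap.adjoint_inner_right]

theorem idealGMRES_le_lambda (hn : 0 < n) (A : Matrix (Fin n) (Fin n) ℂ) (k : ℕ)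
    (hM : (hermitianPart A).PosDef) : idealGMRES k A ≤
        (1 - lambdaMin hM.isHermitian ^ 2 /
            lambdaMax (Matrix.isHermitian_conjTranspose_mul_self A)) ^ ((k : ℝ) / 2) := by
  have : Nonempty (Fin n) := ⟨⟨0, hn⟩⟩
  have hm (v : EuclideanSpace ℂ (Fin n)) :
      lambdaMin hM.isHermitian * ‖v‖ ^ 2 ≤ (inner ℂ v (𝓛 A v)).re := by
    refine (lambdaMin_mul_le hM.isHermitian v).trans_eq ?_
    rw [hermitianPart, map_smul, map_add, _root_.smul_apply,
      _root_.add_apply, inner_smul_right, inner_add_right, inner_toEuclideanCLM_conjTranspose,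
      ← inner_conj_symm (𝓛 A v), Complex.add_conj]
    simp
  have hL (v : EuclideanSpace ℂ (Fin n)) :
      ‖𝓛 A v‖ ^ 2 ≤ lambdaMax (Matrix.isHermitian_conjTranspose_mul_self A) * ‖v‖ ^ 2 := by
    refine Eq.trans_le ?_ (le_lambdaMax_mul _ v)
    rw [map_mul, mul_apply_eq_comp, inner_toEuclideanCLM_conjTranspose, inner_self_eq_norm_sq_to_K]
    norm_cast
  have hm0 : 0 ≤ lambdaMin hM.isHermitian := le_ciInf fun i => (hM.eigenvalues_pos i).le
  set m := lambdaMin hM.isHermitian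
  set L := lambdaMax (Matrix.isHermitian_conjTranspose_mul_self A)
  have hL0 : 0 ≤ L := by
    have := hL (EuclideanSpace.single ⟨0, hn⟩ 1)
    simp only [PiLp.norm_single, norm_one, one_pow, mul_one] at this
    exact (sq_nonneg _).trans this
  refine idealGMRES_le_of_quadratic hn A k ((m / L : ℝ) : ℂ) fun v => ?_
  rw [Complex.re_ofReal_mul, Complex.norm_real, Real.norm_eq_abs, sq_abs]
  have h1 := mul_le_mul_of_nonneg_left (hm v) (div_nonneg hm0 hL0)
  have h2 := mul_le_mul_of_nonneg_left (hL v) (sq_nonneg (m / L))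
  have h3 : (m / L) ^ 2 * (L * ‖v‖ ^ 2) = m ^ 2 / L * ‖v‖ ^ 2 := by
    -- for `L = 0` both sides vanish by the convention `m / 0 = 0`
    rcases hL0.eq_or_lt with h | h
    · simp [← h]
    · field_simp
  have h4 : m / L * (m * ‖v‖ ^ 2) = m ^ 2 / L * ‖v‖ ^ 2 := by ring
  linarith

end Residual

theorem mainTheorem1 (n : ℕ) (hn : 0 < n) (A : Matrix (Fin n) (Fin n) ℂ) (hA : IsUnit A) (k : ℕ) :
    IsLeast (residualNorms k A) (idealGMRES k A) ∧
    idealGMRES k A ≤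
      (1 - distOrigin (fieldOfValues A) * distOrigin (fieldOfValues A⁻¹)) ^ ((k : ℝ) / 2) ∧
    ∀ hM : (hermitianPart A).PosDef,
      idealGMRES k A ≤
        (1 - lambdaMin hM.isHermitian ^ 2 /
            lambdaMax (Matrix.isHermitian_conjTranspose_mul_self A)) ^ ((k : ℝ) / 2) :=
  ⟨isLeast_idealGMRES k A, idealGMRES_le_fieldOfValues hn A hA k,
    idealGMRES_le_lambda hn A k⟩
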